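/- Let $n,k$ be natural numbers and let $\mu,\nu$ be partitions of $k$, where the number $\ell(\mu)$ of nonzero parts of $\mu$ satisfies $\ell(\mu)\le n$. Let $\mathcal H=(\mathbb C^n)^{\otimes k}$, with the diagonal action of $GL(n,\mathbb C)$ and hence of its subgroup $\mathfrak S_n$ of permutation matrices, so that $g(e_{i_1}\otimes\dots\otimes e_{i_k})=e_{g(i_1)}\otimes\dots\otimes e_{g(i_k)}$ for $g\in\mathfrak S_n$. Let $\mathcal H^{\rm mult}_\mu$ be the span of those basis tensors $e_{i_1}\otimes\dots\otimes e_{i_k}$ for which, for every $j\ge 1$, the number of values that occur exactly $j$ times among $i_1,\dots,i_k$ is the number of parts of $\mu$ equal to $j$. Let $\mathcal H^{\rm SW}_\nu$ be the isotypic component in $\mathcal H$ of the irreducible representation of $GL(n,\mathbb C)$ with signature (highest weight) $\nu$ (it is $0$ if $\nu$ has more than $n$ nonzero parts). Let $\rho_{\mu,\nu}$ be the representation of $\mathfrak S_n$ in $\mathcal H_{\mu,\nu}=\mathcal H^{\rm mult}_\mu\cap\mathcal H^{\rm SW}_\nu$. Then $\rho_{\mu,\nu}$ is nonzero (that is, $\mathcal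 H_{\mu,\nu}\neq 0$) if and only if $\nu\unrhd\mu$ in the dominance order, that is, $\nu_1+\dots+\nu_j\ge\mu_1+\dots+\mu_j$ for all $j\ge1$. -/

import Mathlib

open scoped TensorProduct

namespace TensorDecomposition

/-! ### Partitions -/

/-- The `i`-th largest part of a partition (counting from `i = 0`), and `0` if there are at most
`i` parts. -/
def part {k : ℕ} (p : Nat.Partition k) (i : ℕ) : ℕ :=
  (p.parts.sort (· ≥ ·)).getD i 0

/-- The number of nonzero parts of a partition. -/
def length {k : ℕ} (p : Nat.Partition k) : ℕ :=
  Multiset.card p.parts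

/-- The dominance order: `Dominates ν μ` says
`μ₁ + ⋯ + μⱼ ≤ ν₁ + ⋯ + νⱼ` for all `j`. -/
def Dominates {k : ℕ} (ν μ : Nat.Partition k) : Prop :=
  ∀ j : ℕ, ∑ i ∈ Finset.range j, part μ i ≤ ∑ i ∈ Finset.range j, part ν i

/-! ### The space of tensors and the two group actions -/

/-- The space `(ℂⁿ)^{⊗ k}`. -/
abbrev TensorSpace (n k : ℕ) : Type :=
  ⨂[ℂ] _ : Fin k, (Fin n → ℂ)

/-- The basis tensor `e_{i₁} ⊗ ⋯ ⊗ e_{i_k}`. -/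
noncomputable def basisTensor {n k : ℕ} (i : Fin k → Fin n) : TensorSpace n k :=
  PiTensorProduct.tprod ℂ fun t => (Pi.single (i t) 1 : Fin n → ℂ)

/-- The diagonal action `g (v₁ ⊗ ⋯ ⊗ v_k) = g v₁ ⊗ ⋯ ⊗ g v_k` of `GL(n, ℂ)` on tensors. -/
noncomputable def glRep (n k : ℕ) :
    Representation ℂ (Matrix.GeneralLinearGroup (Fin n) ℂ) (TensorSpace n k) where
  toFun g := PiTensorProduct.map fun _ => Matrix.toLin' (g : Matrix (Fin n) (Fin n) ℂ)
  map_one' := by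
    simp only [Units.val_one, Matrix.toLin'_one]
    exact PiTensorProduct.map_id
  map_mul' g h := by
    simp only [Units.val_mul, Matrix.toLin'_mul]
    exact PiTensorProduct.map_comp _ _

theorem glRep_tprod {n k : ℕ} (g : Matrix.GeneralLinearGroup (Fin n) ℂ)
    (v : Fin k → Fin n → ℂ) :
    glRep n k g (PiTensorProduct.tprod ℂ v) =
      PiTensorProduct.tprod ℂ fun t => (g : Matrix (Fin n) (Fin n) ℂ).mulVec (v t) := by
  change PiTensorProduct.map _ _ = _
  simp [PiTensorProduct.map_tprod]

/-- The symmetric group as a subgroup of `GL(n, ℂ)`: the matrix of `g` sends `eᵢ` to `e_{g i}`. -/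
noncomputable def permToGL (n : ℕ) :
    Equiv.Perm (Fin n) →* Matrix.GeneralLinearGroup (Fin n) ℂ where
  toFun g :=
    { val := (g⁻¹).permMatrix ℂ
      inv := g.permMatrix ℂ
      val_inv := by rw [← Matrix.permMatrix_mul, mul_inv_cancel, Matrix.permMatrix_one]
      inv_val := by rw [← Matrix.permMatrix_mul, inv_mul_cancel, Matrix.permMatrix_one] }
  map_one' := by
    ext : 1
    simp
  map_mul' g h := by
    ext : 1
    simp only [Units.val_mul, mul_inv_rev, Matrix.permMatrix_mul]

/-- The action of the symmetric group on tensors, through `GL(n, ℂ)`. -/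
noncomputable def permRep (n k : ℕ) :
    Representation ℂ (Equiv.Perm (Fin n)) (TensorSpace n k) :=
  (glRep n k).comp (permToGL n)

theorem permRep_basisTensor {n k : ℕ} (g : Equiv.Perm (Fin n)) (i : Fin k → Fin n) :
    permRep n k g (basisTensor i) = basisTensor fun t => g (i t) := by
  change glRep n k (permToGL n g) (PiTensorProduct.tprod ℂ _) = PiTensorProduct.tprod ℂ _
  rw [glRep_tprod]
  congr 1
  funext t
  change ((g⁻¹).permMatrix ℂ).mulVec _ = _
  rw [Matrix.permMatrix_mulVec]
  funext j
  have h : g⁻¹ j = i t ↔ j = g (i t) := Equiv.Perm.inv_eq_iff_eq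
  simp only [Function.comp_apply, Pi.single_apply, h]

/-! ### Tensors of a given type -/

/-- A multi-index `i₁, …, i_k` is of type `μ = (1^{m₁} 2^{m₂} …)` if, for every `j ≥ 1`, exactly
`m_j` of the values `1, …, n` occur in it with multiplicity `j`. -/
def IsOfType {n k : ℕ} (μ : Nat.Partition k) (i : Fin k → Fin n) : Prop :=
  ∀ j : ℕ, 1 ≤ j →
    (Finset.univ.filter fun a : Fin n => (Finset.univ.filter fun t => i t = a).card = j).card =
      μ.parts.count j

theorem IsOfType.perm {n k : ℕ} {μ : Nat.Partition k} {i : Fin k → Fin n} (h : IsOfType μ i)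
    (g : Equiv.Perm (Fin n)) : IsOfType μ fun t => g (i t) := by
  intro j hj
  rw [← h j hj]
  refine (Finset.card_equiv g fun a => ?_).symm
  simp

/-- `H^mult_μ`, the span of the basis tensors whose multi-index is of type `μ`, as an
`S_n`-subrepresentation of `(ℂⁿ)^{⊗ k}`. -/
noncomputable def multPart (n : ℕ) {k : ℕ} (μ : Nat.Partition k) :
    Subrepresentation (permRep n k) where
  toSubmodule := Submodule.span ℂ {x | ∃ i : Fin k → Fin n, IsOfType μ i ∧ x = basisTensor i}
  apply_mem_toSubmodule g v hv := by
    induction hv using Submodule.span_induction with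
    | mem x hx =>
      obtain ⟨i, hi, rfl⟩ := hx
      rw [permRep_basisTensor]
      exact Submodule.subset_span ⟨_, hi.perm g, rfl⟩
    | zero => simp
    | add x y _ _ hx hy => rw [map_add]; exact Submodule.add_mem _ hx hy
    | smul c x _ hx => rw [map_smul]; exact Submodule.smul_mem _ c hx

/-! ### Tensors of a given symmetry type -/

/-- `v` is a highest weight vector of weight `ν` (a partition with at most `n` parts): it is a
nonzero common eigenvector of the upper triangular matrices, on which such a matrix `b` acts as
the scalar `∏ᵢ bᵢᵢ ^ νᵢ`. -/
def IsHighestWeightVector {n k : ℕ} {V : Type*} [AddCommGroup V] [Module ℂ V]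
    (ρ : Representation ℂ (Matrix.GeneralLinearGroup (Fin n) ℂ) V) (ν : Nat.Partition k)
    (v : V) : Prop :=
  length ν ≤ n ∧ v ≠ 0 ∧
    ∀ b : Matrix.GeneralLinearGroup (Fin n) ℂ,
      (b : Matrix (Fin n) (Fin n) ℂ).BlockTriangular id →
        ρ b v = (∏ i : Fin n, (b : Matrix (Fin n) (Fin n) ℂ) i i ^ part ν i) • v

/-- The representation `ρ` of `GL(n, ℂ)` is irreducible with signature (highest weight) `ν`. -/
def IsIrreducibleWithSignature {n k : ℕ} {V : Type*} [AddCommGroup V] [Module ℂ V]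
    (ρ : Representation ℂ (Matrix.GeneralLinearGroup (Fin n) ℂ) V) (ν : Nat.Partition k) : Prop :=
  ρ.IsIrreducible ∧ ∃ v : V, IsHighestWeightVector ρ ν v

/-- `H^SW_ν`, the isotypic component of the irreducible representation of `GL(n, ℂ)` with
signature `ν` in `(ℂⁿ)^{⊗ k}`: the sum of all irreducible `GL(n, ℂ)`-subrepresentations with
signature `ν`. -/
noncomputable def swPart (n : ℕ) {k : ℕ} (ν : Nat.Partition k) :
    Subrepresentation (glRep n k) where
  toSubmodule :=
    ⨆ (W : Subrepresentation (glRep n k)) (_ : IsIrreducibleWithSignature (V := W.toSubmodule) W.toRepresentation ν),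
      W.toSubmodule
  apply_mem_toSubmodule g v hv := by
    suffices h : (⨆ (W : Subrepresentation (glRep n k))
        (_ : IsIrreducibleWithSignature (V := W.toSubmodule) W.toRepresentation ν), W.toSubmodule) ≤
        (⨆ (W : Subrepresentation (glRep n k))
          (_ : IsIrreducibleWithSignature (V := W.toSubmodule) W.toRepresentation ν),
            W.toSubmodule).comap (glRep n k g) from h hv
    refine iSup₂_le fun W hW x hx => ?_
    exact le_iSup₂ (f := fun (W : Subrepresentation (glRep n k))
      (_ : IsIrreducibleWithSignature (V := W.toSubmodule) W.toRepresentation ν) => W.toSubmodule) W hW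
      (W.apply_mem_toSubmodule g hx)

/-- Restriction of a `GL(n, ℂ)`-subrepresentation of `(ℂⁿ)^{⊗ k}` to `S_n ⊂ GL(n, ℂ)`. -/
noncomputable def restrictToPerm {n k : ℕ} (W : Subrepresentation (glRep n k)) :
    Subrepresentation (permRep n k) where
  toSubmodule := W.toSubmodule
  apply_mem_toSubmodule g _ hv := W.apply_mem_toSubmodule (permToGL n g) hv

/-! ### The representations `ρ_{μ,ν}` -/

/-- `H_{μ,ν} = H^mult_μ ∩ H^SW_ν`. -/
noncomputable def doublePart (n : ℕ) {k : ℕ} (μ ν : Nat.Partition k) :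
    Subrepresentation (permRep n k) :=
  multPart n μ ⊓ restrictToPerm (swPart n ν)

/-- `ρ_{μ,ν}`, the representation of `S_n` in `H_{μ,ν}`. -/
noncomputable def rho (n : ℕ) {k : ℕ} (μ ν : Nat.Partition k) :
    Representation ℂ (Equiv.Perm (Fin n)) (doublePart n μ ν).toSubmodule :=
  (doublePart n μ ν).toRepresentation

/-- A representation is nonzero if the space in which it acts is not the zero space. -/
def IsNonzero {G V : Type*} [Monoid G] [AddCommMonoid V] [Module ℂ V]
    (_ρ : Representation ℂ G V) : Prop :=
  Nontrivial V

end TensorDecomposition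

/-! The content of a multi-index is its torus weight, so for `length μ ≤ n` the space `multPart n μ`
is the sum of the weight spaces whose weight is a rearrangement of μ padded by zeros. The claim is
thus that μ, up to rearrangement, is a weight of `swPart n ν` exactly when ν dominates μ.

Necessity: a permutation matrix makes the content decreasing, and `card_le_of_mem_swPart` bounds its
partial sums by those of ν. The bound is proved for translates of a highest weight vector
(`IsHighestWeightVector.coord_matAct_eq_zero`) and spreads by irreducibility.

Sufficiency: the column-antisymmetrized tensor of a Young diagram of ν is a highest weight vector,
hence lies in `swPart n ν` by complete reducibility. Its translate by a Vandermonde matrix has a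
nonzero coordinate at every filling with distinct entries in each column. Unit moves
(`mem_of_dominated`, `exists_content_move`) give such a filling of content μ, and the weight
component of the translate at that content is the required vector. -/

namespace TensorDecomposition

/-! ### Partitions as sequences -/

section Partitions

variable {k : ℕ} (p : Nat.Partition k)

theorem map_part_range (d : ℕ) :
    (Multiset.range (length p + d)).map (part p) = p.parts + Multiset.replicate d 0 := by
  have h : (List.range (length p + d)).map (part p) =
      p.parts.sort (· ≥ ·) ++ List.replicate d 0 := by
    refine List.ext_getElem (by simp [length]) fun i h₁ h₂ => ?_
    rcases lt_or_ge i (p.parts.sort (· ≥ ·)).length with hi | hi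
    · rw [List.getElem_append_left hi, List.getElem_map, List.getElem_range, part,
        List.getD_eq_getElem _ _ hi]
    · rw [List.getElem_append_right hi, List.getElem_map, List.getElem_range, part,
        List.getD_eq_default _ _ hi, List.getElem_replicate]
  calc (Multiset.range (length p + d)).map (part p)
      = (((List.range (length p + d)).map (part p) : List ℕ) : Multiset ℕ) := rfl
    _ = _ := by
      rw [h, ← Multiset.coe_add, Multiset.sort_eq]
      rfl

theorem part_antitone : Antitone (part p) := by
  intro i j hij
  rcases lt_or_ge j (p.parts.sort (· ≥ ·)).length with hj | hj
  · have hi := hij.trans_lt hj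
    simp only [part, List.getD_eq_getElem _ _ hj, List.getD_eq_getElem _ _ hi]
    rcases hij.eq_or_lt with rfl | hij
    · exact le_rfl
    · exact List.pairwise_iff_getElem.1 (Multiset.pairwise_sort p.parts (· ≥ ·)) i j hi hj hij
  · rw [part, List.getD_eq_default _ _ hj]
    exact Nat.zero_le _

theorem part_pos {i : ℕ} (hi : i < length p) : 0 < part p i := by
  have hi' : i < (p.parts.sort (· ≥ ·)).length := by simpa [length] using hi
  rw [part, List.getD_eq_getElem _ _ hi']
  exact p.parts_pos ((Multiset.mem_sort _).1 (List.getElem_mem hi'))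

theorem sum_part_range {N : ℕ} (hN : length p ≤ N) : ∑ i ∈ Finset.range N, part p i = k := by
  obtain ⟨d, rfl⟩ := Nat.exists_eq_add_of_le hN
  change ((Multiset.range (length p + d)).map (part p)).sum = k
  rw [map_part_range]
  simp [p.parts_sum]

theorem sum_part_range_le (N : ℕ) : ∑ i ∈ Finset.range N, part p i ≤ k := by
  exact (Finset.sum_le_sum_of_subset (Finset.range_subset_range.2 (le_max_right _ _))).trans_eq
    (sum_part_range p (le_max_left (length p) N))

theorem sum_part_fin {n : ℕ} (hn : length p ≤ n) : ∑ a : Fin n, part p a = k := by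
  rw [Fin.sum_univ_eq_sum_range (part p) n, sum_part_range p hn]

theorem sum_filter_val_lt {n m : ℕ} (hm : m ≤ n) :
    ∑ a ∈ Finset.univ.filter (fun a : Fin n => a.val < m), part p a =
      ∑ a ∈ Finset.range m, part p a := by
  rw [Finset.sum_filter, Fin.sum_univ_eq_sum_range (fun a => if a < m then part p a else 0) n,
    ← Finset.sum_filter]
  congr 1
  ext a
  simp only [Finset.mem_filter, Finset.mem_range]
  omega

theorem card_filter_part {n : ℕ} (hn : length p ≤ n) {j : ℕ} (hj : 1 ≤ j) :
    (Finset.univ.filter fun a : Fin n => part p a = j).card = p.parts.count j := by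
  obtain ⟨d, rfl⟩ := Nat.exists_eq_add_of_le hn
  have h := congrArg (Multiset.count j) (map_part_range p d)
  rw [Multiset.count_add, Multiset.count_replicate, if_neg (by omega), add_zero,
    Multiset.count_map] at h
  rw [← h, Finset.card_filter, Fin.sum_univ_eq_sum_range (fun a => if part p a = j then 1 else 0),
    ← Finset.card_filter]
  simp only [eq_comm]
  rfl

/-- The first `length p` parts of `q` already sum to `k`, which leaves no room for another positive
part. -/
theorem length_le_of_dominates {p q : Nat.Partition k} (h : Dominates q p) :
    length q ≤ length p := by
  by_contra! hlt
  have h₁ := h (length p)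
  rw [sum_part_range p le_rfl] at h₁
  have h₂ := sum_part_range_le q (length p + 1)
  rw [Finset.sum_range_succ] at h₂
  have := part_pos q hlt
  omega

end Partitions

/-! ### Contents of multi-indices -/

/-- The number of occurrences of the value `a` in the multi-index `i`. -/
def content {n k : ℕ} (i : Fin k → Fin n) (a : Fin n) : ℕ :=
  (Finset.univ.filter fun t => i t = a).card

theorem exists_perm_of_card_fiber_eq {α β : Type*} [Fintype α] [DecidableEq β] (f g : α → β)
    (h : ∀ b, (Finset.univ.filter fun a => f a = b).card =
      (Finset.univ.filter fun a => g a = b).card) :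
    ∃ σ : Equiv.Perm α, ∀ a, g (σ a) = f a := by
  have e (b : β) : {a // f a = b} ≃ {a // g a = b} :=
    Fintype.equivOfCardEq (by simpa [Fintype.card_subtype] using h b)
  refine ⟨(Equiv.sigmaFiberEquiv f).symm.trans
    ((Equiv.sigmaCongrRight e).trans (Equiv.sigmaFiberEquiv g)), fun a => ?_⟩
  exact (e (f a) ⟨a, rfl⟩).2

theorem IsOfType.exists_perm {n k : ℕ} {μ : Nat.Partition k} (hn : length μ ≤ n)
    {i : Fin k → Fin n} (hi : IsOfType μ i) :
    ∃ σ : Equiv.Perm (Fin n), ∀ a, content i (σ a) = part μ a := by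
  refine exists_perm_of_card_fiber_eq _ _ fun b => ?_
  have key : ∀ b, 1 ≤ b → (Finset.univ.filter fun a : Fin n => part μ a = b).card =
      (Finset.univ.filter fun a : Fin n => content i a = b).card := fun b hb =>
    (card_filter_part μ hn hb).trans (hi b hb).symm
  -- The type does not constrain absent values; their number is what remains of the total `n` once
  -- the positive multiplicities agree.
  rcases Nat.eq_zero_or_pos b with rfl | hb
  · have h₁ := Finset.card_eq_sum_card_fiberwise (f := fun a : Fin n => part μ a)
      (s := Finset.univ) (t := Finset.range (k + 1)) fun a _ => by
        simpa [Nat.lt_succ_iff, ← sum_part_fin μ hn] using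
          Finset.single_le_sum (f := fun a : Fin n => part μ a) (fun _ _ => Nat.zero_le _)
            (Finset.mem_univ a)
    have h₂ := Finset.card_eq_sum_card_fiberwise (f := content i)
      (s := Finset.univ) (t := Finset.range (k + 1)) fun a _ => by
        simpa [content, Nat.lt_succ_iff] using
          Finset.card_le_univ (Finset.univ.filter fun t => i t = a)
    rw [Finset.sum_range_succ'] at h₁ h₂
    have h₃ := Finset.sum_congr rfl fun b (_ : b ∈ Finset.range k) => key (b + 1) (by omega)
    omega
  · exact key b hb

theorem isOfType_of_content_eq {n k : ℕ} {μ : Nat.Partition k} (hn : length μ ≤ n)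
    {i : Fin k → Fin n} (hi : ∀ a, content i a = part μ a) : IsOfType μ i := by
  intro j hj
  rw [← card_filter_part μ hn hj]
  simp only [← hi]
  rfl

theorem IsOfType.congr {n k : ℕ} {μ : Nat.Partition k} {i j : Fin k → Fin n} (hi : IsOfType μ i)
    (h : content j = content i) : IsOfType μ j := by
  intro m hm
  rw [← hi m hm]
  have h' := fun a => congrFun h a
  simp only [content] at h'
  simp only [h']

/-! ### Moving along the dominance order -/

/-- Induction on the total deficit of `r` below `m`. At the first deficient index `b`, dominance
forces a surplus at some `a < b`, and moving a unit from `a` to `b` lowers the deficit. -/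
theorem mem_of_dominated {n : ℕ} {R : Set (Fin n → ℕ)}
    (hR : ∀ r ∈ R, ∀ a b, r b < r a → ∀ r' : Fin n → ℕ, r' a + 1 = r a → r' b = r b + 1 →
      (∀ c, c ≠ a → c ≠ b → r' c = r c) → r' ∈ R)
    {m : Fin n → ℕ} (hm : Antitone m) {r : Fin n → ℕ} (hr : r ∈ R)
    (hsum : ∑ a, m a = ∑ a, r a)
    (hdom : ∀ b, ∑ a ∈ Finset.Iic b, m a ≤ ∑ a ∈ Finset.Iic b, r a) : m ∈ R := by
  induction hN : ∑ a, (m a - r a) using Nat.strong_induction_on generalizing r with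
  | _ N ih =>
  by_cases hle : ∀ b, m b ≤ r b
  · have : m = r := funext fun a =>
      (Finset.sum_eq_sum_iff_of_le fun a _ => hle a).1 hsum a (Finset.mem_univ _)
    exact this ▸ hr
  push Not at hle
  obtain ⟨b, hb, hmin⟩ : ∃ b, r b < m b ∧ ∀ c < b, m c ≤ r c := by
    obtain ⟨b, hb⟩ := exists_minimal_of_wellFoundedLT (fun b => r b < m b) hle
    exact ⟨b, hb.1, fun c hc => not_lt.1 fun h => hc.not_ge (hb.2 h hc.le)⟩
  have hIic : Finset.Iic b = insert b (Finset.Iio b) := by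
    ext c; simp [le_iff_eq_or_lt]
  obtain ⟨a, hab, ha⟩ : ∃ a < b, m a < r a := by
    by_contra! hcon
    have h₁ := hdom b
    rw [hIic, Finset.sum_insert (by simp), Finset.sum_insert (by simp)] at h₁
    have h₂ : ∑ c ∈ Finset.Iio b, r c ≤ ∑ c ∈ Finset.Iio b, m c :=
      Finset.sum_le_sum fun c hc => hcon c (Finset.mem_Iio.1 hc)
    omega
  have hba : m b ≤ m a := hm hab.le
  set r' : Fin n → ℕ := Function.update (Function.update r a (r a - 1)) b (r b + 1) with hr'
  have hra : r' a = r a - 1 := by simp [hr', hab.ne]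
  have hrb : r' b = r b + 1 := by simp [hr']
  have hrc : ∀ c, c ≠ a → c ≠ b → r' c = r c := fun c h₁ h₂ => by simp [hr', h₁, h₂]
  -- The move is allowed because `r b < m b ≤ m a < r a`.
  have hmem : r' ∈ R := hR r hr a b (by omega) r' (by omega) hrb hrc
  have hshift : ∀ s : Finset (Fin n), a ∈ s → b ∈ s → ∑ c ∈ s, r' c = ∑ c ∈ s, r c := by
    intro s has hbs
    have hbs' : b ∈ s.erase a := Finset.mem_erase.2 ⟨hab.ne', hbs⟩
    have hrest : ∑ c ∈ (s.erase a).erase b, r' c = ∑ c ∈ (s.erase a).erase b, r c := by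
      refine Finset.sum_congr rfl fun c hc => ?_
      simp only [Finset.mem_erase] at hc
      exact hrc c hc.2.1 hc.1
    rw [← Finset.add_sum_erase s _ has, ← Finset.add_sum_erase s _ has,
      ← Finset.add_sum_erase _ _ hbs', ← Finset.add_sum_erase _ _ hbs', hrest, hra, hrb]
    omega
  refine ih (∑ c, (m c - r' c)) ?_ hmem (by rw [hshift _ (by simp) (by simp), hsum])
    (fun c => ?_) rfl
  · rw [← hN]
    refine Finset.sum_lt_sum (fun c _ => ?_) ⟨b, Finset.mem_univ _, by omega⟩
    by_cases hca : c = a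
    · subst hca; omega
    · by_cases hcb : c = b
      · subst hcb; omega
      · rw [hrc c hca hcb]
  -- Prefixes containing `b` keep their sum; on shorter ones `m ≤ r'` holds termwise, since `b` was
  -- the first deficient index.
  · rcases le_or_gt b c with hbc | hcb
    · rw [hshift _ (by simpa using hab.le.trans hbc) (by simpa using hbc)]
      exact hdom c
    · refine Finset.sum_le_sum fun d hd => ?_
      have hdb : d < b := (Finset.mem_Iic.1 hd).trans_lt hcb
      by_cases hda : d = a
      · subst hda; omega
      · rw [hrc d hda hdb.ne]
        exact hmin d hdb

/-- The contents of the fillings with distinct entries in every column are closed under moving a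
unit from a more frequent value to a less frequent one. -/
theorem exists_content_move {n k : ℕ} {col : Fin k → ℕ} {i : Fin k → Fin n}
    (hi : ∀ s t, col s = col t → i s = i t → s = t) {a b : Fin n}
    (hab : content i b < content i a) {r : Fin n → ℕ} (ha : r a + 1 = content i a)
    (hb : r b = content i b + 1) (hc : ∀ c, c ≠ a → c ≠ b → r c = content i c) :
    ∃ j : Fin k → Fin n, (∀ s t, col s = col t → j s = j t → s = t) ∧ content j = r := by
  have hne : a ≠ b := by rintro rfl; omega
  -- Some column contains `a` but not `b`: otherwise sending each `a` to a `b` in its column would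
  -- be injective, contradicting `hab`.
  obtain ⟨t₀, ht₀, hcol⟩ : ∃ t₀, i t₀ = a ∧ ∀ s, i s = b → col s ≠ col t₀ := by
    by_contra! hcon
    choose! f hf hfc using hcon
    refine hab.not_ge (Finset.card_le_card_of_injOn f (fun t ht => ?_) fun s hs t ht hst => ?_)
    · simpa using hf t (by simpa using ht)
    · have hs' : i s = a := by simpa using hs
      have ht' : i t = a := by simpa using ht
      exact hi s t (by rw [← hfc s hs', ← hfc t ht', hst]) (hs'.trans ht'.symm)
  refine ⟨Function.update i t₀ b, fun s t hst hval => ?_, funext fun c => ?_⟩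
  · by_cases hs : s = t₀ <;> by_cases ht : t = t₀
    · rw [hs, ht]
    · subst hs
      simp only [Function.update_self, Function.update_of_ne ht] at hval
      exact absurd hst.symm (hcol t hval.symm)
    · subst ht
      simp only [Function.update_self, Function.update_of_ne hs] at hval
      exact absurd hst (hcol s hval)
    · simp only [Function.update_of_ne hs, Function.update_of_ne ht] at hval
      exact hi s t hst hval
  · by_cases hca : c = a
    · subst hca
      have : (Finset.univ.filter fun t => Function.update i t₀ b t = c) =
          (Finset.univ.filter fun t => i t = c).erase t₀ := by
        ext t
        by_cases ht : t = t₀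
        · subst ht; simp [hne.symm]
        · simp [ht]
      rw [content, this, Finset.card_erase_of_mem (by simpa using ht₀)]
      change content i c - 1 = _
      omega
    · by_cases hcb : c = b
      · subst hcb
        have : (Finset.univ.filter fun t => Function.update i t₀ c t = c) =
            insert t₀ (Finset.univ.filter fun t => i t = c) := by
          ext t
          by_cases ht : t = t₀
          · subst ht; simp
          · simp [ht]
        rw [content, this, Finset.card_insert_of_notMem (by simpa [ht₀] using hne), hb]
        rfl
      · rw [hc c hca hcb]
        refine congrArg Finset.card (Finset.filter_congr fun t _ => ?_)
        by_cases ht : t = t₀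
        · subst ht; simp [ht₀, Ne.symm hca, Ne.symm hcb]
        · simp [ht]

/-! ### Coordinates of tensors -/

section Coordinates

variable {n k : ℕ}

/-- The basis of `(ℂⁿ)^{⊗ k}` formed by the basis tensors. -/
noncomputable def tensorBasis (n k : ℕ) : Module.Basis (Fin k → Fin n) ℂ (TensorSpace n k) :=
  Basis.piTensorProduct fun _ => Pi.basisFun ℂ (Fin n)

theorem tensorBasis_apply (i : Fin k → Fin n) : tensorBasis n k i = basisTensor i := by
  simp [tensorBasis, basisTensor]

/-- The coordinates of a tensor in the basis of basis tensors. -/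
noncomputable def coord : TensorSpace n k ≃ₗ[ℂ] ((Fin k → Fin n) → ℂ) :=
  (tensorBasis n k).equivFun

theorem coord_tprod (v : Fin k → Fin n → ℂ) (i : Fin k → Fin n) :
    coord (PiTensorProduct.tprod ℂ v) i = ∏ t, v t (i t) := by
  simp [coord, tensorBasis]

theorem coord_basisTensor (i j : Fin k → Fin n) :
    coord (basisTensor i) j = if i = j then 1 else 0 := by
  rw [← tensorBasis_apply, coord, Module.Basis.equivFun_self]

/-- The diagonal action of all matrices on tensors. -/
noncomputable def matAct (M : Matrix (Fin n) (Fin n) ℂ) : TensorSpace n k →ₗ[ℂ] TensorSpace n k :=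
  PiTensorProduct.map fun _ => Matrix.toLin' M

theorem glRep_apply (g : Matrix.GeneralLinearGroup (Fin n) ℂ) (x : TensorSpace n k) :
    glRep n k g x = matAct (g : Matrix (Fin n) (Fin n) ℂ) x := rfl

theorem matAct_mul (M N : Matrix (Fin n) (Fin n) ℂ) (x : TensorSpace n k) :
    matAct (M * N) x = matAct M (matAct N x) := by
  simp only [matAct, Matrix.toLin'_mul]
  exact LinearMap.congr_fun (PiTensorProduct.map_comp _ _) x

theorem coord_matAct (M : Matrix (Fin n) (Fin n) ℂ) (x : TensorSpace n k) (i : Fin k → Fin n) :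
    coord (matAct M x) i = ∑ j, (∏ t, M (i t) (j t)) * coord x j := by
  have h : LinearMap.proj i ∘ₗ coord.toLinearMap ∘ₗ matAct M =
      ∑ j, (∏ t, M (i t) (j t)) • (LinearMap.proj j ∘ₗ coord.toLinearMap) := by
    refine (tensorBasis n k).ext fun l => ?_
    rw [tensorBasis_apply]
    simp only [LinearMap.comp_apply, LinearMap.proj_apply, LinearEquiv.coe_coe,
      LinearMap.sum_apply, LinearMap.smul_apply, coord_basisTensor, smul_eq_mul, mul_ite, mul_one,
      mul_zero, Finset.sum_ite_eq, Finset.mem_univ, if_true]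
    rw [basisTensor, matAct, PiTensorProduct.map_tprod, coord_tprod]
    simp
  simpa using LinearMap.congr_fun h x

theorem coord_glRep_permToGL (g : Equiv.Perm (Fin n)) (x : TensorSpace n k) (i : Fin k → Fin n) :
    coord (glRep n k (permToGL n g) x) (fun t => g (i t)) = coord x i := by
  have h : LinearMap.proj (fun t => g (i t)) ∘ₗ coord.toLinearMap ∘ₗ glRep n k (permToGL n g) =
      LinearMap.proj i ∘ₗ coord.toLinearMap := by
    refine (tensorBasis n k).ext fun l => ?_
    rw [tensorBasis_apply]
    have := permRep_basisTensor g l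
    simp only [LinearMap.comp_apply, LinearMap.proj_apply, LinearEquiv.coe_coe]
    erw [this]
    rw [coord_basisTensor, coord_basisTensor]
    simp [funext_iff]
  exact LinearMap.congr_fun h x

theorem mem_multPart_iff {μ : Nat.Partition k} {x : TensorSpace n k} :
    x ∈ (multPart n μ).toSubmodule ↔ ∀ i, coord x i ≠ 0 → IsOfType μ i := by
  have h : {x | ∃ i : Fin k → Fin n, IsOfType μ i ∧ x = basisTensor i} =
      tensorBasis n k '' {i | IsOfType μ i} := by
    ext x
    simp [tensorBasis_apply, eq_comm]
  change x ∈ Submodule.span ℂ {x | ∃ i : Fin k → Fin n, IsOfType μ i ∧ x = basisTensor i} ↔ _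
  rw [h, Module.Basis.mem_span_image]
  simp [Set.subset_def, coord]

/-! ### Diagonal matrices and weights -/

/-- The diagonal matrix with entry `2` at the places in `s` and `1` elsewhere. -/
noncomputable def scaleGL (s : Finset (Fin n)) : Matrix.GeneralLinearGroup (Fin n) ℂ :=
  Matrix.GeneralLinearGroup.mkOfDetNeZero (Matrix.diagonal fun a => if a ∈ s then 2 else 1) <| by
    rw [Matrix.det_diagonal, Finset.prod_ne_zero_iff]
    intro a _
    split_ifs <;> norm_num

theorem scaleGL_coe (s : Finset (Fin n)) : (scaleGL s : Matrix (Fin n) (Fin n) ℂ) =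
    Matrix.diagonal fun a => if a ∈ s then 2 else 1 := rfl

theorem coord_scaleGL (s : Finset (Fin n)) (x : TensorSpace n k) (i : Fin k → Fin n) :
    coord (glRep n k (scaleGL s) x) i =
      2 ^ (Finset.univ.filter fun t => i t ∈ s).card * coord x i := by
  rw [glRep_apply, coord_matAct, scaleGL_coe, Finset.sum_eq_single i]
  · simp [Matrix.diagonal_apply_eq, Finset.prod_ite]
  · intro j _ hj
    obtain ⟨t, ht⟩ := Function.ne_iff.1 hj
    have h : ∏ t, (Matrix.diagonal fun a => if a ∈ s then (2 : ℂ) else 1) (i t) (j t) = 0 :=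
      Finset.prod_eq_zero (Finset.mem_univ t) (by exact Matrix.diagonal_apply_ne _ ht.symm)
    rw [h, zero_mul]
  · simp

/-- This replaces projection to a weight space. If a content other than that of `i` occurs, the two
differ at some value `a`; subtracting a scalar from `scaleGL {a}` kills that content, keeps the
coordinate at `i` nonzero and shrinks the support. -/
theorem exists_mem_coord_ne_zero_of_content (U : Subrepresentation (glRep n k))
    {x : TensorSpace n k} (hx : x ∈ U.toSubmodule) {i : Fin k → Fin n} (hi : coord x i ≠ 0) :
    ∃ y ∈ U.toSubmodule, coord y i ≠ 0 ∧ ∀ j, coord y j ≠ 0 → content j = content i := by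
  induction hN : (Finset.univ.filter fun j => coord x j ≠ 0).card using Nat.strong_induction_on
    generalizing x with
  | _ N ih =>
  by_cases hall : ∀ j, coord x j ≠ 0 → content j = content i
  · exact ⟨x, hx, hi, hall⟩
  push Not at hall
  obtain ⟨j, hj, hji⟩ := hall
  obtain ⟨a, ha⟩ := Function.ne_iff.1 hji
  set y : TensorSpace n k := glRep n k (scaleGL {a}) x - (2 : ℂ) ^ content j a • x with hy
  have hcoord (l) : coord y l = ((2 : ℂ) ^ content l a - 2 ^ content j a) * coord x l := by
    rw [hy, map_sub, map_smul, Pi.sub_apply, Pi.smul_apply, coord_scaleGL, smul_eq_mul, sub_mul]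
    simp [content]
  have hyU : y ∈ U.toSubmodule :=
    U.toSubmodule.sub_mem (U.apply_mem_toSubmodule _ hx) (U.toSubmodule.smul_mem _ hx)
  refine ih _ ?_ hyU ?_ rfl
  · rw [← hN]
    refine Finset.card_lt_card (Finset.ssubset_iff.2 ⟨j, by simp [hcoord], ?_⟩)
    refine Finset.insert_subset (by simpa using hj) fun l hl => ?_
    simp only [Finset.mem_filter, Finset.mem_univ, true_and, hcoord] at hl ⊢
    exact right_ne_zero_of_mul hl
  · rw [hcoord]
    refine mul_ne_zero (sub_ne_zero.2 fun h => ha ?_) hi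
    exact (Nat.pow_right_injective le_rfl (by exact_mod_cast h)).symm

/-! ### Complete reducibility -/

/-- For the standard Hermitian form the adjoint of `g` is its conjugate transpose, again in the
group, so orthogonal complements are invariant. -/
theorem exists_isCompl (U : Subrepresentation (glRep n k)) :
    ∃ U' : Subrepresentation (glRep n k), IsCompl U.toSubmodule U'.toSubmodule := by
  let Φ : TensorSpace n k ≃ₗ[ℂ] EuclideanSpace ℂ (Fin k → Fin n) :=
    coord.trans (WithLp.linearEquiv 2 ℂ _).symm
  have hinner (x y : TensorSpace n k) :
      inner ℂ (Φ x) (Φ y) = ∑ i, star (coord x i) * coord y i := by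
    simp [Φ, PiLp.inner_apply, mul_comm]
  have hadj (g : Matrix.GeneralLinearGroup (Fin n) ℂ) (x y : TensorSpace n k) :
      inner ℂ (Φ x) (Φ (glRep n k g y)) = inner ℂ (Φ (glRep n k (star g) x)) (Φ y) := by
    simp only [hinner, glRep_apply, coord_matAct, star_sum, Finset.mul_sum, Finset.sum_mul]
    rw [Finset.sum_comm]
    refine Finset.sum_congr rfl fun j _ => Finset.sum_congr rfl fun i _ => ?_
    simp only [star_mul', star_prod, Units.coe_star, Matrix.star_apply, star_star]
    ring
  refine ⟨⟨(U.toSubmodule.map Φ.toLinearMap)ᗮ.comap Φ.toLinearMap, fun g y hy => ?_⟩, ?_⟩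
  · rw [Submodule.mem_comap, Submodule.mem_orthogonal] at hy ⊢
    rintro _ ⟨x, hx, rfl⟩
    exact (hadj g x y).trans (hy _ ⟨_, U.apply_mem_toSubmodule (star g) hx, rfl⟩)
  · have h := Submodule.isCompl_orthogonal (U.toSubmodule.map Φ.toLinearMap)
    have h' := h.map (Submodule.orderIsoMapComap Φ).symm
    simpa [Submodule.comap_map_eq_of_injective Φ.injective] using h'

end Coordinates

/-! ### Weights of an irreducible representation are dominated by its highest weight -/

section Weights

variable {n k : ℕ}

theorem isHighestWeightVector_coe_iff {ν : Nat.Partition k} (W : Subrepresentation (glRep n k))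
    (w : W.toSubmodule) :
    IsHighestWeightVector W.toRepresentation ν w ↔
      IsHighestWeightVector (glRep n k) ν (w : TensorSpace n k) := by
  simp only [IsHighestWeightVector, ne_eq, Subtype.ext_iff]
  rfl

theorem IsHighestWeightVector.card_eq {ν : Nat.Partition k} {v : TensorSpace n k}
    (hv : IsHighestWeightVector (glRep n k) ν v) {j : Fin k → Fin n} (hj : coord v j ≠ 0)
    (s : Finset (Fin n)) :
    (Finset.univ.filter fun t => j t ∈ s).card = ∑ a ∈ s, part ν a := by
  have h := hv.2.2 (scaleGL s) (by
    rw [scaleGL_coe]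
    exact Matrix.blockTriangular_diagonal _)
  have h' := congrFun (congrArg coord h) j
  rw [coord_scaleGL, map_smul, Pi.smul_apply, smul_eq_mul] at h'
  have h'' := mul_right_cancel₀ hj h'
  simp only [scaleGL_coe, Matrix.diagonal_apply_eq, ite_pow, one_pow, Finset.prod_ite_mem,
    Finset.univ_inter, Finset.prod_pow_eq_pow_sum] at h''
  exact Nat.pow_right_injective le_rfl (by exact_mod_cast h'')

/-- Each multi-index in the support of `v` has too few letters in `s` to match `i`, so every term of
the coordinate contains an entry of the vanishing block. -/
theorem IsHighestWeightVector.coord_matAct_eq_zero_of_block_eq_zero {ν : Nat.Partition k}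
    {v : TensorSpace n k} (hv : IsHighestWeightVector (glRep n k) ν v) {s : Finset (Fin n)}
    {i : Fin k → Fin n} (hi : ∑ a ∈ s, part ν a < (Finset.univ.filter fun t => i t ∈ s).card)
    {M : Matrix (Fin n) (Fin n) ℂ} (hM : ∀ a ∈ s, ∀ b ∉ s, M a b = 0) :
    coord (matAct M v) i = 0 := by
  rw [coord_matAct]
  refine Finset.sum_eq_zero fun j _ => ?_
  by_cases hj : coord v j = 0
  · rw [hj, mul_zero]
  · rw [← hv.card_eq hj s] at hi
    obtain ⟨t, ht, ht'⟩ := Finset.exists_mem_notMem_of_card_lt_card hi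
    rw [Finset.prod_eq_zero (Finset.mem_univ t)
      (hM _ (by simpa using ht) _ (by simpa using ht')), zero_mul]

/-- Since `s` is an initial segment, column operations that clear the block with rows in `s` and
columns outside it form an upper unitriangular matrix `1 + E`, which fixes `v`. -/
theorem IsHighestWeightVector.coord_matAct_eq_zero_of_det_ne_zero {ν : Nat.Partition k}
    {v : TensorSpace n k} (hv : IsHighestWeightVector (glRep n k) ν v) {s : Finset (Fin n)}
    (hs : ∀ a ∈ s, ∀ b ∉ s, a < b)
    {i : Fin k → Fin n} (hi : ∑ a ∈ s, part ν a < (Finset.univ.filter fun t => i t ∈ s).card)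
    {M : Matrix (Fin n) (Fin n) ℂ}
    (hM : (M.submatrix (Subtype.val : s → Fin n) Subtype.val).det ≠ 0) :
    coord (matAct M v) i = 0 := by
  set A := M.submatrix (Subtype.val : s → Fin n) Subtype.val with hA
  let E : Matrix (Fin n) (Fin n) ℂ := fun c b =>
    if h : c ∈ s ∧ b ∉ s then -(A⁻¹.mulVec fun a => M a b) ⟨c, h.1⟩ else 0
  have hE : ∀ c b, ¬ c < b → E c b = 0 := fun c b hcb =>
    dif_neg fun h => hcb (hs c h.1 b h.2)
  have htri : (1 + E).BlockTriangular id := fun c b hbc => by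
    have hbc' : b < c := hbc
    rw [Matrix.add_apply, hE c b hbc'.not_gt, Matrix.one_apply_ne hbc'.ne', add_zero]
  have hdiag (a) : (1 + E) a a = 1 := by
    rw [Matrix.add_apply, hE a a (lt_irrefl a), Matrix.one_apply_eq, add_zero]
  let u : Matrix.GeneralLinearGroup (Fin n) ℂ := Matrix.GeneralLinearGroup.mkOfDetNeZero (1 + E) (by
    rw [Matrix.det_of_isUpperTriangular htri]
    simp [hdiag])
  have hu : matAct (1 + E) v = v := by
    have h := hv.2.2 u htri
    have hd (a) : (u : Matrix (Fin n) (Fin n) ℂ) a a = 1 := hdiag a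
    simp only [hd, one_pow, Finset.prod_const_one, one_smul] at h
    exact h
  rw [← hu, ← matAct_mul]
  refine hv.coord_matAct_eq_zero_of_block_eq_zero hi fun a ha b hb => ?_
  have hsum : ∑ c, M a c * E c b = -(A.mulVec (A⁻¹.mulVec fun a => M a b)) ⟨a, ha⟩ := by
    rw [← Finset.sum_subset s.subset_univ fun c _ hc => ?_, ← Finset.sum_coe_sort s,
      Matrix.mulVec, dotProduct, ← Finset.sum_neg_distrib]
    · refine Finset.sum_congr rfl fun c _ => ?_
      rw [show E c b = _ from dif_pos ⟨c.2, hb⟩, mul_neg]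
      rfl
    · rw [show E c b = 0 from dif_neg fun h => hc h.1, mul_zero]
  rw [mul_add, mul_one, Matrix.add_apply, Matrix.mul_apply, hsum, Matrix.mulVec_mulVec,
    Matrix.mul_nonsing_inv _ (isUnit_iff_ne_zero.2 hM), Matrix.one_mulVec, add_neg_cancel]

theorem IsHighestWeightVector.coord_matAct_eq_zero {ν : Nat.Partition k}
    {v : TensorSpace n k} (hv : IsHighestWeightVector (glRep n k) ν v) {s : Finset (Fin n)}
    (hs : ∀ a ∈ s, ∀ b ∉ s, a < b)
    {i : Fin k → Fin n} (hi : ∑ a ∈ s, part ν a < (Finset.univ.filter fun t => i t ∈ s).card)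
    (M : Matrix (Fin n) (Fin n) ℂ) :
    coord (matAct M v) i = 0 := by
  let P : Polynomial ℂ := ∑ j, (∏ t, (Polynomial.C (M (i t) (j t)) +
    Polynomial.X * Polynomial.C ((1 : Matrix (Fin n) (Fin n) ℂ) (i t) (j t)))) *
      Polynomial.C (coord v j)
  have hP (z : ℂ) : P.eval z = coord (matAct (M + z • (1 : Matrix (Fin n) (Fin n) ℂ)) v) i := by
    simp only [P, coord_matAct, Polynomial.eval_finsetSum, Polynomial.eval_mul,
      Polynomial.eval_prod, Polynomial.eval_add, Polynomial.eval_C, Polynomial.eval_X,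
      Matrix.add_apply, Matrix.smul_apply, smul_eq_mul]
  let A : Matrix s s ℂ := M.submatrix (Subtype.val : s → Fin n) Subtype.val
  -- The characteristic polynomial of `-A` at `z` is the determinant of the `s`-block of `M + z •
  -- 1`; where it is nonzero, the invertible case gives `P.eval z = 0`.
  have hzero : P * (-A).charpoly = 0 := by
    refine Polynomial.funext fun z => ?_
    rw [Polynomial.eval_mul, Polynomial.eval_zero, mul_eq_zero, or_iff_not_imp_right]
    intro hz
    rw [hP]
    refine hv.coord_matAct_eq_zero_of_det_ne_zero hs hi fun h => hz ?_
    rw [Matrix.eval_charpoly, ← h]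
    congr 1
    ext a b
    by_cases hab : a = b
    · subst hab
      simp [A, add_comm]
    · simp [A, hab, Subtype.coe_injective.ne hab]
  have hP0 : P = 0 := (mul_eq_zero.1 hzero).resolve_right (Matrix.charpoly_monic _).ne_zero
  have h := hP 0
  rw [hP0, Polynomial.eval_zero, zero_smul, add_zero] at h
  exact h.symm

theorem card_le_of_mem_swPart {ν : Nat.Partition k} {x : TensorSpace n k}
    (hx : x ∈ (swPart n ν).toSubmodule) {i : Fin k → Fin n} (hi : coord x i ≠ 0)
    {s : Finset (Fin n)} (hs : ∀ a ∈ s, ∀ b ∉ s, a < b) :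
    (Finset.univ.filter fun t => i t ∈ s).card ≤ ∑ a ∈ s, part ν a := by
  by_contra! hlt
  suffices h : (swPart n ν).toSubmodule ≤
      LinearMap.ker (LinearMap.proj i ∘ₗ coord.toLinearMap : TensorSpace n k →ₗ[ℂ] ℂ) from
    hi (LinearMap.mem_ker.1 (h hx))
  refine iSup₂_le fun W hW => ?_
  obtain ⟨hirr, v, hv⟩ := hW
  have hv' := (isHighestWeightVector_coe_iff W v).1 hv
  -- The vectors whose whole orbit has zero coordinate at `i` form an invariant subspace containing
  -- `v`, hence all of `W`.
  let K : Subrepresentation W.toRepresentation :=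
    { toSubmodule :=
        { carrier := {w | ∀ g, coord (glRep n k g w) i = 0}
          add_mem' := fun {w w'} h h' g => by simp [h g, h' g]
          zero_mem' := fun g => by simp
          smul_mem' := fun c w h g => by simp [h g] }
      apply_mem_toSubmodule := fun g w h g' => by
        have h' := h (g' * g)
        rwa [map_mul] at h' }
  have hvK : v ∈ K.toSubmodule := fun g => hv'.coord_matAct_eq_zero hs hlt _
  have hK : K = ⊤ := by
    refine (hirr.eq_bot_or_eq_top K).resolve_left fun h => hv.2.1 ?_
    rw [h] at hvK
    exact (Submodule.mem_bot ℂ).1 hvK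
  intro w hw
  have hwK : (⟨w, hw⟩ : W.toSubmodule) ∈ K.toSubmodule := by
    rw [hK]
    exact Submodule.mem_top
  have := hwK 1
  rw [map_one] at this
  exact this

theorem length_le_of_mem_swPart {ν : Nat.Partition k} {x : TensorSpace n k}
    (hx : x ∈ (swPart n ν).toSubmodule) (hx0 : x ≠ 0) : length ν ≤ n := by
  by_contra hn
  have h : (swPart n ν).toSubmodule ≤ ⊥ :=
    iSup₂_le fun W hW => absurd hW.2.choose_spec.1 hn
  exact hx0 ((Submodule.mem_bot ℂ).1 (h hx))

theorem dominates_of_mem {μ ν : Nat.Partition k} (hn : length μ ≤ n) {x : TensorSpace n k}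
    (hx : x ∈ (swPart n ν).toSubmodule) (hμ : x ∈ (multPart n μ).toSubmodule) (hx0 : x ≠ 0) :
    Dominates ν μ := by
  obtain ⟨i, hi⟩ : ∃ i, coord x i ≠ 0 := by
    by_contra! h
    exact hx0 (coord.map_eq_zero_iff.1 (funext h))
  obtain ⟨σ, hσ⟩ := (mem_multPart_iff.1 hμ i hi).exists_perm hn
  have hy := (swPart n ν).apply_mem_toSubmodule (permToGL n σ⁻¹) hx
  have hyi : coord (glRep n k (permToGL n σ⁻¹) x) (fun t => σ⁻¹ (i t)) ≠ 0 := by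
    rwa [coord_glRep_permToGL]
  have hcontent (a) : content (fun t => σ⁻¹ (i t)) a = part μ a := by
    rw [← hσ]
    simp only [content, Equiv.Perm.inv_eq_iff_eq]
  have hνn := length_le_of_mem_swPart hx hx0
  intro m
  -- Beyond `n` both partial sums equal `k`.
  rcases le_total n m with hm | hm
  · rw [sum_part_range μ (hn.trans hm), sum_part_range ν (hνn.trans hm)]
  have h := card_le_of_mem_swPart hy hyi (s := Finset.univ.filter fun a : Fin n => a.val < m)
    (by simp only [Finset.mem_filter, Finset.mem_univ, true_and]; omega)
  rw [← sum_filter_val_lt _ hm, ← sum_filter_val_lt _ hm]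
  refine le_trans (le_of_eq ?_) h
  rw [Finset.card_eq_sum_card_fiberwise (f := fun t => σ⁻¹ (i t))
    (t := Finset.univ.filter fun a : Fin n => a.val < m) (fun t ht => by simpa using ht)]
  refine Finset.sum_congr rfl fun a ha => ?_
  rw [← hcontent, content, Finset.filter_filter]
  congr 1
  ext t
  simp only [Finset.mem_filter, Finset.mem_univ, true_and] at ha ⊢
  constructor
  · rintro rfl; exact ⟨ha, rfl⟩
  · exact fun h => h.2

end Weights

/-! ### Highest weight vectors generate the isotypic component -/

section Isotypic

variable {n k : ℕ}

/-- The eigenvector defect of `u` is minus that of `u'`, so it lies in both invariant subspaces and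
vanishes. -/
theorem IsHighestWeightVector.of_add {ν : Nat.Partition k} {U U' : Subrepresentation (glRep n k)}
    (hU : Disjoint U.toSubmodule U'.toSubmodule) {u u' : TensorSpace n k}
    (hu : u ∈ U.toSubmodule) (hu' : u' ∈ U'.toSubmodule)
    (h : IsHighestWeightVector (glRep n k) ν (u + u')) (h0 : u ≠ 0) :
    IsHighestWeightVector (glRep n k) ν u := by
  refine ⟨h.1, h0, fun b hb => ?_⟩
  have hbu := h.2.2 b hb
  generalize (∏ i : Fin n, (b : Matrix (Fin n) (Fin n) ℂ) i i ^ part ν i) = c at hbu ⊢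
  have hsum : glRep n k b u - c • u = -(glRep n k b u' - c • u') := by
    rw [map_add, smul_add] at hbu
    rw [eq_neg_iff_add_eq_zero, ← sub_eq_zero.2 hbu]
    abel
  refine sub_eq_zero.1 (Submodule.disjoint_def.1 hU _ ?_ ?_)
  · exact U.toSubmodule.sub_mem (U.apply_mem_toSubmodule b hu) (U.toSubmodule.smul_mem c hu)
  · rw [hsum]
    exact U'.toSubmodule.neg_mem
      (U'.toSubmodule.sub_mem (U'.apply_mem_toSubmodule b hu') (U'.toSubmodule.smul_mem c hu'))

/-- An invariant subspace minimal among those containing a highest weight vector of weight ν is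
irreducible. Split `x` along a subrepresentation and its complement: by minimality, a nonzero
component in the former makes it everything, and a zero one makes it trivial. -/
theorem exists_irreducible_le {ν : Nat.Partition k} (X : Subrepresentation (glRep n k))
    {x : TensorSpace n k} (hxX : x ∈ X.toSubmodule)
    (hx : IsHighestWeightVector (glRep n k) ν x) :
    ∃ W : Subrepresentation (glRep n k), W.toSubmodule ≤ X.toSubmodule ∧
      IsIrreducibleWithSignature (V := W.toSubmodule) W.toRepresentation ν := by
  have : Module.Finite ℂ (TensorSpace n k) := Module.Finite.of_basis (tensorBasis n k)
  induction hN : Module.finrank ℂ X.toSubmodule using Nat.strong_induction_on generalizing X x with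
  | _ N ih =>
  by_cases hex : ∃ Y : Subrepresentation (glRep n k), Y.toSubmodule < X.toSubmodule ∧
      ∃ y ∈ Y.toSubmodule, IsHighestWeightVector (glRep n k) ν y
  · obtain ⟨Y, hYX, y, hyY, hy⟩ := hex
    obtain ⟨W, hWY, hW⟩ := ih _ (hN ▸ Submodule.finrank_lt_finrank_of_lt hYX) Y hyY hy rfl
    exact ⟨W, hWY.trans hYX.le, hW⟩
  have hmin : ∀ Y : Subrepresentation (glRep n k), Y.toSubmodule ≤ X.toSubmodule →
      ∀ y ∈ Y.toSubmodule, IsHighestWeightVector (glRep n k) ν y →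
        X.toSubmodule ≤ Y.toSubmodule := fun Y hYX y hyY hy => by
    by_contra h
    exact hex ⟨Y, lt_of_le_not_ge hYX h, y, hyY, hy⟩
  refine ⟨X, le_rfl, { exists_pair_ne := ⟨⊥, ⊤, fun h => ?_⟩, eq_bot_or_eq_top := fun K => ?_ },
    ⟨x, hxX⟩, (isHighestWeightVector_coe_iff X ⟨x, hxX⟩).2 hx⟩
  · have hmem : (⟨x, hxX⟩ : X.toSubmodule) ∈
        (⊥ : Subrepresentation X.toRepresentation).toSubmodule := by
      rw [h]
      exact Submodule.mem_top
    exact hx.2.1 (Subtype.ext_iff.1 ((Submodule.mem_bot ℂ).1 hmem))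
  let Y : Subrepresentation (glRep n k) :=
    { toSubmodule := K.toSubmodule.map X.toSubmodule.subtype
      apply_mem_toSubmodule := by
        rintro g _ ⟨w, hw, rfl⟩
        exact ⟨_, K.apply_mem_toSubmodule g hw, rfl⟩ }
  have hYX : Y.toSubmodule ≤ X.toSubmodule := Submodule.map_subtype_le _ _
  obtain ⟨Y', hYY'⟩ := exists_isCompl Y
  obtain ⟨y, hy, y', hy', rfl⟩ := Submodule.mem_sup.1
    (hYY'.sup_eq_top ▸ Submodule.mem_top : x ∈ Y.toSubmodule ⊔ Y'.toSubmodule)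
  by_cases hy0 : y = 0
  · left
    have hXY' : X.toSubmodule ≤ Y'.toSubmodule :=
      (hmin (Y' ⊓ X) inf_le_right _ ⟨by rwa [hy0, zero_add], hxX⟩ hx).trans inf_le_left
    refine Subrepresentation.toSubmodule_injective ((Submodule.eq_bot_iff _).2 fun w hw => ?_)
    exact Subtype.ext (Submodule.disjoint_def.1 hYY'.disjoint _ ⟨w, hw, rfl⟩ (hXY' w.2))
  · right
    have hXY := hmin Y hYX y hy (hx.of_add hYY'.disjoint hy hy' hy0)
    refine Subrepresentation.toSubmodule_injective ((Submodule.eq_top_iff').2 fun w => ?_)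
    obtain ⟨w', hw', h⟩ := hXY w.2
    exact Subtype.ext h ▸ hw'

/-- A nonzero component of `v` in an invariant complement would be a highest weight vector, so the
complement would contain an irreducible of signature ν, which also lies in `swPart n ν`. -/
theorem IsHighestWeightVector.mem_swPart {ν : Nat.Partition k} {v : TensorSpace n k}
    (hv : IsHighestWeightVector (glRep n k) ν v) : v ∈ (swPart n ν).toSubmodule := by
  obtain ⟨U, hU⟩ := exists_isCompl (swPart n ν)
  obtain ⟨u, hu, u', hu', rfl⟩ := Submodule.mem_sup.1
    (hU.sup_eq_top ▸ Submodule.mem_top : v ∈ (swPart n ν).toSubmodule ⊔ U.toSubmodule)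
  by_cases h0 : u' = 0
  · rwa [h0, add_zero]
  exfalso
  rw [add_comm] at hv
  obtain ⟨W, hWU, hW⟩ := exists_irreducible_le U hu' (hv.of_add hU.disjoint.symm hu' hu h0)
  have hWsw : W.toSubmodule ≤ (swPart n ν).toSubmodule :=
    le_iSup₂ (f := fun (W : Subrepresentation (glRep n k))
      (_ : IsIrreducibleWithSignature (V := W.toSubmodule) W.toRepresentation ν) =>
        W.toSubmodule) W hW
  obtain ⟨w, hw⟩ := hW.2
  exact hw.2.1 (Subtype.ext (Submodule.disjoint_def.1 hU.disjoint _ (hWsw w.2) (hWU w.2)))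

end Isotypic

/-! ### Column antisymmetrized tensors -/

section ColumnVector

variable {n k : ℕ}

/-- The positions `1, …, k` are identified with the cells of the Young diagram of `ν`. -/
structure IsDiagram (ν : Nat.Partition k) (row : Fin k → Fin n) (col : Fin k → ℕ) : Prop where
  content_row : ∀ a, content row a = part ν a
  injective : ∀ s t, col s = col t → row s = row t → s = t
  exists_above : ∀ s, ∀ a ≤ row s, ∃ t, col t = col s ∧ row t = a

theorem exists_isDiagram {ν : Nat.Partition k} (hn : length ν ≤ n) :
    ∃ (row : Fin k → Fin n) (col : Fin k → ℕ), IsDiagram ν row col := by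
  let e : Fin k ≃ Σ a : Fin n, Fin (part ν a) := Fintype.equivOfCardEq (by
    simp [sum_part_fin ν hn])
  refine ⟨fun t => (e t).1, fun t => (e t).2, fun a => ?_, fun s t hc hr => ?_, fun s a ha => ?_⟩
  · rw [content, ← Fintype.card_subtype,
      Fintype.card_congr ((e.subtypeEquiv fun t => Iff.rfl).trans
        (Equiv.sigmaSubtype (β := fun a : Fin n => Fin (part ν a)) a)), Fintype.card_fin]
  · refine e.injective ?_
    generalize e s = x at hc hr
    generalize e t = y at hc hr
    obtain ⟨a, x⟩ := x
    obtain ⟨b, y⟩ := y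
    obtain rfl : a = b := hr
    exact congrArg _ (Fin.ext hc)
  · exact ⟨e.symm ⟨a, (e s).2, (e s).2.2.trans_le (part_antitone ν ha)⟩,
      by rw [e.apply_symm_apply], by rw [e.apply_symm_apply]⟩

/-- The matrix whose determinant is the coordinate at `i` of the image under `M` of the column
antisymmetrized tensor. -/
def colMatrix (row : Fin k → Fin n) (col : Fin k → ℕ) (i : Fin k → Fin n)
    (M : Matrix (Fin n) (Fin n) ℂ) : Matrix (Fin k) (Fin k) ℂ :=
  Matrix.of fun s t => if col t = col s then M (i t) (row s) else 0

/-- The product over the columns of a diagram of the tensors `e₁ ∧ e₂ ∧ ⋯`. -/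
noncomputable def columnVector (row : Fin k → Fin n) (col : Fin k → ℕ) : TensorSpace n k :=
  ∑ σ : Equiv.Perm (Fin k), (if ∀ t, col t = col (σ t) then ((Equiv.Perm.sign σ : ℤ) : ℂ) else 0) •
    basisTensor fun t => row (σ t)

theorem coord_matAct_columnVector (row : Fin k → Fin n) (col : Fin k → ℕ) (i : Fin k → Fin n)
    (M : Matrix (Fin n) (Fin n) ℂ) :
    coord (matAct M (columnVector row col)) i = (colMatrix row col i M).det := by
  rw [Matrix.det_apply', columnVector, map_sum, map_sum, Finset.sum_apply]
  refine Finset.sum_congr rfl fun σ _ => ?_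
  rw [map_smul, map_smul, Pi.smul_apply, coord_matAct, smul_eq_mul]
  simp only [coord_basisTensor, mul_ite, mul_one, mul_zero, Finset.sum_ite_eq, Finset.mem_univ,
    if_true, colMatrix, Matrix.of_apply, Finset.prod_ite_zero, true_imp_iff, ite_mul, zero_mul]

/-- Columns of a diagram are top-justified, so within a column an upper triangular `b` maps the span
of its row vectors to itself. This factors the matrix through `B`, which is block triangular by rows
with scalar diagonal blocks of size `part ν a`. -/
theorem det_colMatrix_of_blockTriangular {ν : Nat.Partition k} {row : Fin k → Fin n}
    {col : Fin k → ℕ} (hD : IsDiagram ν row col) (i : Fin k → Fin n)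
    {b : Matrix (Fin n) (Fin n) ℂ} (hb : b.BlockTriangular id) :
    (colMatrix row col i b).det = (∏ a, b a a ^ part ν a) * (colMatrix row col i 1).det := by
  let B : Matrix (Fin k) (Fin k) ℂ :=
    Matrix.of fun t s => if col s = col t then b (row t) (row s) else 0
  have hmul : colMatrix row col i b = B.transpose * colMatrix row col i 1 := by
    ext s t
    simp only [colMatrix, B, Matrix.mul_apply, Matrix.transpose_apply, Matrix.of_apply,
      Matrix.one_apply]
    by_cases hst : col t = col s
    · rw [if_pos hst]
      by_cases hex : ∃ u, col u = col s ∧ row u = i t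
      · obtain ⟨u, hu, hui⟩ := hex
        rw [Finset.sum_eq_single u]
        · simp [hu, hst, hui]
        · intro u' _ hne
          by_cases hc : col t = col u'
          · rw [if_pos hc, if_neg (c := i t = row u') fun h => hne ?_, mul_zero]
            exact hD.injective _ _ (by rw [← hc, hst, hu]) (h.symm.trans hui.symm)
          · rw [if_neg hc, mul_zero]
        · simp
      · rw [Finset.sum_eq_zero fun u _ => ?_]
        -- A letter that is not a row of this column lies strictly below `row s`, where `b`
        -- vanishes.
        · refine hb (lt_of_not_ge fun h => hex (hD.exists_above s (i t) h))
        · by_cases hc : col t = col u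
          · rw [if_pos hc, if_neg (c := i t = row u)
              fun h => hex ⟨u, by rw [← hc, hst], h.symm⟩, mul_zero]
          · rw [if_neg hc, mul_zero]
    · rw [if_neg hst, Finset.sum_eq_zero fun u _ => ?_]
      by_cases hc : col t = col u
      · rw [if_neg (fun h => hst (hc.trans h.symm)), zero_mul]
      · rw [if_neg hc, mul_zero]
  have hB : B.BlockTriangular row := fun t s hst => by
    simp only [B, Matrix.of_apply]
    split_ifs
    · exact hb hst
    · rfl
  rw [hmul, Matrix.det_mul, Matrix.det_transpose, hB.det_fintype]
  congr 1
  refine Finset.prod_congr rfl fun a _ => ?_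
  have hdiag : B.toSquareBlock row a = Matrix.diagonal fun _ => b a a := by
    ext ⟨s, hs⟩ ⟨t, ht⟩
    rw [Matrix.toSquareBlock_def, Matrix.of_apply, Matrix.diagonal_apply]
    simp only [B, Matrix.of_apply, hs, ht, Subtype.mk.injEq]
    by_cases hst : s = t
    · rw [if_pos (by rw [hst]), if_pos hst]
    · rw [if_neg fun h => hst (hD.injective s t h.symm (hs.trans ht.symm)), if_neg hst]
  rw [hdiag, Matrix.det_diagonal, Finset.prod_const, Finset.card_univ, ← hD.content_row a,
    Fintype.card_subtype, content]

/-- On each column, a left kernel vector gives the coefficients of a polynomial of degree less than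
the column length that vanishes at the column's distinct entries, so it is zero. -/
theorem det_colMatrix_vandermonde_ne_zero {ν : Nat.Partition k} {row : Fin k → Fin n}
    {col : Fin k → ℕ} (hD : IsDiagram ν row col) {i : Fin k → Fin n}
    (hi : ∀ s t, col s = col t → i s = i t → s = t) :
    (colMatrix row col i (Matrix.vandermonde fun a : Fin n => ((a : ℕ) : ℂ))).det ≠ 0 := by
  intro hdet
  obtain ⟨w, hw0, hw⟩ := Matrix.exists_vecMul_eq_zero_iff.2 hdet
  refine hw0 (funext fun s₀ => ?_)
  let S : Finset (Fin k) := Finset.univ.filter fun s => col s = col s₀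
  have hS {s} : s ∈ S ↔ col s = col s₀ := by simp [S]
  let P : Polynomial ℂ := ∑ s ∈ S, Polynomial.C (w s) * Polynomial.X ^ (row s : ℕ)
  have hinj : Set.InjOn (fun t => ((i t : ℕ) : ℂ)) S := fun s hs t ht h =>
    hi s t ((hS.1 hs).trans (hS.1 ht).symm) (Fin.ext (Nat.cast_injective h))
  have hP : P = 0 := by
    refine Polynomial.eq_zero_of_degree_lt_of_eval_finset_eq_zero
      (S.image fun t => ((i t : ℕ) : ℂ)) ?_ ?_
    · rw [Finset.card_image_of_injOn hinj, ← Polynomial.mem_degreeLT]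
      refine Submodule.sum_mem _ fun s hs => Polynomial.mem_degreeLT.2 ?_
      refine (Polynomial.degree_C_mul_X_pow_le _ _).trans_lt ?_
      have hsub : Finset.Iic (row s) ⊆ S.image row := fun a ha => by
        obtain ⟨t, ht, rfl⟩ := hD.exists_above s a (Finset.mem_Iic.1 ha)
        exact Finset.mem_image_of_mem _ (hS.2 (ht.trans (hS.1 hs)))
      have := (Finset.card_le_card hsub).trans Finset.card_image_le
      rw [Fin.card_Iic] at this
      exact_mod_cast this
    · intro z hz
      obtain ⟨t, ht, rfl⟩ := Finset.mem_image.1 hz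
      have h := congrFun hw t
      simp only [Matrix.vecMul, dotProduct, colMatrix, Matrix.of_apply, Matrix.vandermonde_apply,
        mul_ite, mul_zero, Pi.zero_apply, hS.1 ht] at h
      rw [← Finset.sum_filter] at h
      simp only [P, Polynomial.eval_finsetSum, Polynomial.eval_mul, Polynomial.eval_C,
        Polynomial.eval_pow, Polynomial.eval_X]
      simpa only [S, eq_comm] using h
  have hcoeff := congrArg (fun Q => Polynomial.coeff Q (row s₀)) hP
  simp only [P, Polynomial.finsetSum_coeff, Polynomial.coeff_C_mul_X_pow,
    Polynomial.coeff_zero] at hcoeff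
  rw [Finset.sum_eq_single s₀ (fun s hs hne => if_neg fun h => hne
    (hD.injective s s₀ (hS.1 hs) (Fin.ext h.symm))) fun h => absurd (hS.2 rfl) h,
    if_pos rfl] at hcoeff
  exact hcoeff

theorem isHighestWeightVector_columnVector {ν : Nat.Partition k} (hn : length ν ≤ n)
    {row : Fin k → Fin n} {col : Fin k → ℕ} (hD : IsDiagram ν row col) :
    IsHighestWeightVector (glRep n k) ν (columnVector row col) := by
  refine ⟨hn, fun h => ?_, fun b hb => coord.injective (funext fun i => ?_)⟩
  -- The filling by row indices is itself column-distinct, so the Vandermonde translate is nonzero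
  -- there.
  · refine det_colMatrix_vandermonde_ne_zero hD hD.injective ?_
    rw [← coord_matAct_columnVector, h, map_zero, map_zero, Pi.zero_apply]
  · have h1 := coord_matAct_columnVector row col i 1
    have hone : matAct 1 (columnVector row col) = columnVector row col :=
      LinearMap.congr_fun ((glRep n k).map_one) _
    rw [hone] at h1
    rw [glRep_apply, coord_matAct_columnVector, det_colMatrix_of_blockTriangular hD i hb, map_smul,
      Pi.smul_apply, h1, smul_eq_mul]

theorem exists_mem_of_dominates {μ ν : Nat.Partition k} (hn : length μ ≤ n)
    (h : Dominates ν μ) : ∃ x ∈ (swPart n ν).toSubmodule,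
      x ∈ (multPart n μ).toSubmodule ∧ x ≠ 0 := by
  have hνn := (length_le_of_dominates h).trans hn
  obtain ⟨row, col, hD⟩ := exists_isDiagram hνn
  obtain ⟨i, hi, hic⟩ : (fun a : Fin n => part μ a) ∈ {r : Fin n → ℕ | ∃ i : Fin k → Fin n,
      (∀ s t, col s = col t → i s = i t → s = t) ∧ content i = r} := by
    -- The moves start from the filling by row indices, whose content is ν.
    refine mem_of_dominated (r := fun a => part ν a) ?_ (fun a b hab => part_antitone μ hab)
      ⟨row, hD.injective, funext hD.content_row⟩ (by rw [sum_part_fin μ hn, sum_part_fin ν hνn])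
      fun b => ?_
    · rintro _ ⟨i, hi, rfl⟩ a b hab r' ha hb hc
      exact exists_content_move hi hab ha hb hc
    · have hIic : Finset.Iic b = Finset.univ.filter fun a : Fin n => a.val < b + 1 := by
        ext a
        simp
      rw [hIic, sum_filter_val_lt μ b.2, sum_filter_val_lt ν b.2]
      exact h (b + 1)
  let g : Matrix.GeneralLinearGroup (Fin n) ℂ := Matrix.GeneralLinearGroup.mkOfDetNeZero
    (Matrix.vandermonde fun a : Fin n => ((a : ℕ) : ℂ))
    (Matrix.det_vandermonde_ne_zero_iff.2 fun a b hab => Fin.ext (by exact_mod_cast hab))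
  have hgv := (swPart n ν).apply_mem_toSubmodule g
    (isHighestWeightVector_columnVector hνn hD).mem_swPart
  have hgi : coord (glRep n k g (columnVector row col)) i ≠ 0 := by
    rw [glRep_apply, coord_matAct_columnVector]
    exact det_colMatrix_vandermonde_ne_zero hD hi
  obtain ⟨y, hy, hyi, hyc⟩ := exists_mem_coord_ne_zero_of_content _ hgv hgi
  refine ⟨y, hy, mem_multPart_iff.2 fun j hj => ?_, fun h0 => hyi ?_⟩
  · exact (isOfType_of_content_eq hn (congrFun hic)).congr (hyc j hj)
  · rw [h0, map_zero, Pi.zero_apply]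

end ColumnVector

end TensorDecomposition

theorem proposition1 (n k : ℕ) (μ ν : Nat.Partition k)
    (hn : TensorDecomposition.length μ ≤ n) :
    TensorDecomposition.IsNonzero (TensorDecomposition.rho n μ ν) ↔
      TensorDecomposition.Dominates ν μ := by
  refine (Submodule.nontrivial_iff_ne_bot).trans
    ((Submodule.ne_bot_iff _).trans ⟨?_, fun h => ?_⟩)
  · rintro ⟨x, ⟨hμ, hν⟩, hx0⟩
    exact TensorDecomposition.dominates_of_mem hn hν hμ hx0
  · obtain ⟨x, hν, hμ, hx0⟩ := TensorDecomposition.exists_mem_of_dominates hn h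
    exact ⟨x, ⟨hμ, hν⟩, hx0⟩
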